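/- Let $p : E \to M$ be a smooth real vector bundle of finite rank over a smooth finite-dimensional manifold. Let $K$ be a linear connection on $E$, i.e. a smooth linear splitting $K : E \to J^1E$ of $J^1E \to E$. Regard $K$ as a $TE$-valued $1$-form $K : E \to T^*M \otimes TE$ projecting on the identity of $TM$, hence as a tangent-valued $1$-form on the manifold $E$, $\xi \mapsto K_e(T_e p(\xi))$ for $\xi \in T_eE$. Let $[\,,]$ be the Frölicher–Nijenhuis bracket of tangent-valued forms on the manifold $E$, and let $R[K] = -[K,K]$ be the curvature of $K$, which is a smooth tangent-valued $2$-form on $E$. Then the generalized Bianchi identity $$[K, R[K]] = 0$$ holds. -/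

import Mathlib

open scoped Manifold ContDiff

noncomputable section

section TangentValuedForms

variable {EN : Type*} [NormedAddCommGroup EN] [NormedSpace ℝ EN]
  {HN : Type*} [TopologicalSpace HN] (J : ModelWithCorners ℝ EN HN)
  (N : Type*) [TopologicalSpace N] [ChartedSpace HN N]

/-- A field on the manifold `N` which assigns to each point `x` a function of `k` tangent vectors
at `x` with values in the tangent space at `x`. The tangent-valued `k`-forms on `N` are those
satisfying `IsTangentValuedForm`. -/
abbrev TangentValuedField (k : ℕ) : Type _ :=
  ∀ x : N, (Fin k → TangentSpace J x) → TangentSpace J x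

variable {J N}

/-- The vector field `A(X₁, …, X_k)`. -/
def applyFields {k : ℕ} (A : TangentValuedField J N k)
    (X : Fin k → ∀ x : N, TangentSpace J x) : ∀ x : N, TangentSpace J x :=
  fun x => A x (fun i => X i x)

/-- `A` is a smooth tangent-valued `k`-form, `A ∈ Ω^k(N; TN)`: it is pointwise multilinear and
alternating, and it maps smooth (germs of) vector fields to smooth (germs of) vector fields. -/
structure IsTangentValuedForm [IsManifold J 1 N] {k : ℕ} (A : TangentValuedField J N k) :
    Prop where
  alternating : ∀ x : N,
    ∃ B : AlternatingMap ℝ (TangentSpace J x) (TangentSpace J x) (Fin k), A x = ⇑B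
  smooth : ∀ (x : N) (X : Fin k → ∀ y : N, TangentSpace J y),
    (∀ i, ContMDiffAt J J.tangent ∞
      (fun y => (⟨y, X i y⟩ : TangentBundle J N)) x) →
    ContMDiffAt J J.tangent ∞
      (fun y => (⟨y, applyFields A X y⟩ : TangentBundle J N)) x

/-- The Frölicher-Nijenhuis bracket `[K, L]` of tangent-valued forms `K` of degree `p = k + 1` and
`L` of degree `q = l + 1`, evaluated on vector fields `X₁, …, X_{p+q}`, where `[ , ]` is the
Lie bracket of vector fields:
`[K, L](X₁, …, X_{p+q})
  = 1 / (p! q!) ∑ sgn σ [K(X_{σ1}, …, X_{σp}), L(X_{σ(p+1)}, …, X_{σ(p+q)})]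
  - 1 / (p! (q-1)!) ∑ sgn σ L([K(X_{σ1}, …, X_{σp}), X_{σ(p+1)}], X_{σ(p+2)}, …)
  + (-1)^{pq} / ((p-1)! q!) ∑ sgn σ K([L(X_{σ1}, …, X_{σq}), X_{σ(q+1)}], X_{σ(q+2)}, …)
  + (-1)^{p-1} / ((p-1)! (q-1)! 2!) ∑ sgn σ L(K([X_{σ1}, X_{σ2}], X_{σ3}, …), X_{σ(p+2)}, …)
  + (-1)^{(p-1)q} / ((p-1)! (q-1)! 2!) ∑ sgn σ K(L([X_{σ1}, X_{σ2}], X_{σ3}, …), X_{σ(q+2)}, …)`,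
the sums being over all permutations `σ` of the `p + q` indices. -/
def fnBracketOnFields {k l : ℕ}
    (K : TangentValuedField J N (k + 1)) (L : TangentValuedField J N (l + 1))
    (X : Fin ((k + 1) + (l + 1)) → ∀ x : N, TangentSpace J x) : ∀ x : N, TangentSpace J x :=
  fun x =>
  (1 / ((k + 1).factorial * (l + 1).factorial : ℝ)) •
      ∑ σ : Equiv.Perm (Fin ((k + 1) + (l + 1))), ((Equiv.Perm.sign σ : ℤ) : ℝ) •
        VectorField.mlieBracket J
          (applyFields K fun i => X (σ ⟨i, by omega⟩))
          (applyFields L fun j => X (σ ⟨k + 1 + j, by omega⟩)) x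
  - (1 / ((k + 1).factorial * l.factorial : ℝ)) •
      ∑ σ : Equiv.Perm (Fin ((k + 1) + (l + 1))), ((Equiv.Perm.sign σ : ℤ) : ℝ) •
        applyFields L (Fin.cons
          (VectorField.mlieBracket J
            (applyFields K fun i => X (σ ⟨i, by omega⟩)) (X (σ ⟨k + 1, by omega⟩)))
          (fun j : Fin l => X (σ ⟨k + 2 + j, by omega⟩))) x
  + ((-1) ^ ((k + 1) * (l + 1)) / (k.factorial * (l + 1).factorial : ℝ)) •
      ∑ σ : Equiv.Perm (Fin ((k + 1) + (l + 1))), ((Equiv.Perm.sign σ : ℤ) : ℝ) •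
        applyFields K (Fin.cons
          (VectorField.mlieBracket J
            (applyFields L fun j => X (σ ⟨j, by omega⟩)) (X (σ ⟨l + 1, by omega⟩)))
          (fun i : Fin k => X (σ ⟨l + 2 + i, by omega⟩))) x
  + ((-1) ^ k / (k.factorial * l.factorial * 2 : ℝ)) •
      ∑ σ : Equiv.Perm (Fin ((k + 1) + (l + 1))), ((Equiv.Perm.sign σ : ℤ) : ℝ) •
        applyFields L (Fin.cons
          (applyFields K (Fin.cons
            (VectorField.mlieBracket J (X (σ ⟨0, by omega⟩)) (X (σ ⟨1, by omega⟩)))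
            (fun i : Fin k => X (σ ⟨2 + i, by omega⟩))))
          (fun j : Fin l => X (σ ⟨k + 2 + j, by omega⟩))) x
  + ((-1) ^ (k * (l + 1)) / (k.factorial * l.factorial * 2 : ℝ)) •
      ∑ σ : Equiv.Perm (Fin ((k + 1) + (l + 1))), ((Equiv.Perm.sign σ : ℤ) : ℝ) •
        applyFields K (Fin.cons
          (applyFields L (Fin.cons
            (VectorField.mlieBracket J (X (σ ⟨0, by omega⟩)) (X (σ ⟨1, by omega⟩)))
            (fun j : Fin l => X (σ ⟨2 + j, by omega⟩))))
          (fun i : Fin k => X (σ ⟨l + 2 + i, by omega⟩))) x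

/-- The Frölicher-Nijenhuis bracket of tangent-valued forms of degrees `k + 1` and `l + 1`, as a
field of degree `(k + 1) + (l + 1)`. For smooth forms `K` and `L` the expression
`fnBracketOnFields K L X x` depends only on the values of the vector fields `X i` at `x`; here
tangent vectors at `x` are extended to vector fields, smooth near `x`, which are constant in the
preferred trivialization of the tangent bundle at `x`. -/
def fnBracket [IsManifold J 1 N] {k l : ℕ}
    (K : TangentValuedField J N (k + 1)) (L : TangentValuedField J N (l + 1)) :
    TangentValuedField J N ((k + 1) + (l + 1)) :=
  fun x v => fnBracketOnFields K L (fun i => FiberBundle.extend EN (v i)) x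

end TangentValuedForms

section LinearConnections

variable {EM : Type*} [NormedAddCommGroup EM] [NormedSpace ℝ EM]
  {HM : Type*} [TopologicalSpace HM] (I : ModelWithCorners ℝ EM HM)
  {M : Type*} [TopologicalSpace M] [ChartedSpace HM M] [IsManifold I ∞ M]
  (F : Type*) [NormedAddCommGroup F] [NormedSpace ℝ F]
  (E : M → Type*) [TopologicalSpace (Bundle.TotalSpace F E)]
  [∀ x, AddCommGroup (E x)] [∀ x, Module ℝ (E x)] [∀ x, TopologicalSpace (E x)]
  [FiberBundle F E] [VectorBundle ℝ F E] [ContMDiffVectorBundle ∞ F E I]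

/-- A linear connection on the vector bundle `p : E → M`, that is, a smooth linear splitting
`K : E → J¹E` of `J¹E → E`. The fibre of `J¹E` over `e` consists of the linear maps
`T_{p e} M → T_e E` which are right inverse to `T_e p`; the one-jet at `x` of a section `s`
is the differential of `s` at `x`. -/
structure LinearConnection where
  /-- The value `K e : T_{p e} M → T_e E`, for `e` in the total space. -/
  lift : ∀ e : Bundle.TotalSpace F E,
    TangentSpace I e.proj →L[ℝ] TangentSpace (I.prod 𝓘(ℝ, F)) e
  /-- `K e` belongs to the fibre of `J¹E` over `e`. -/
  splitting : ∀ (e : Bundle.TotalSpace F E) (u : TangentSpace I e.proj),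
    mfderiv (I.prod 𝓘(ℝ, F)) I (Bundle.TotalSpace.proj : Bundle.TotalSpace F E → M) e
      (lift e u) = u
  /-- `K` is smooth: near each point, the linear maps `K e`, read in the tangent coordinates on `M`
  and on the total space, depend smoothly on `e`. -/
  smooth : ∀ e₀ : Bundle.TotalSpace F E,
    ContMDiffAt (I.prod 𝓘(ℝ, F)) 𝓘(ℝ, EM →L[ℝ] EM × F) ∞
      (inTangentCoordinates I (I.prod 𝓘(ℝ, F)) Bundle.TotalSpace.proj id lift e₀) e₀
  /-- `K` is additive with respect to `j¹ₓ s + j¹ₓ t = j¹ₓ (s + t)`. -/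
  map_add : ∀ (x : M) (s t : ∀ y : M, E y),
    ContMDiffAt I (I.prod 𝓘(ℝ, F)) ∞ (fun y => (⟨y, s y⟩ : Bundle.TotalSpace F E)) x →
    ContMDiffAt I (I.prod 𝓘(ℝ, F)) ∞ (fun y => (⟨y, t y⟩ : Bundle.TotalSpace F E)) x →
    lift ⟨x, s x⟩ =
      mfderiv I (I.prod 𝓘(ℝ, F)) (fun y => (⟨y, s y⟩ : Bundle.TotalSpace F E)) x →
    lift ⟨x, t x⟩ =
      mfderiv I (I.prod 𝓘(ℝ, F)) (fun y => (⟨y, t y⟩ : Bundle.TotalSpace F E)) x →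
    lift ⟨x, s x + t x⟩ =
      mfderiv I (I.prod 𝓘(ℝ, F)) (fun y => (⟨y, s y + t y⟩ : Bundle.TotalSpace F E)) x
  /-- `K` is homogeneous with respect to `c • j¹ₓ s = j¹ₓ (c • s)`. -/
  map_smul : ∀ (x : M) (c : ℝ) (s : ∀ y : M, E y),
    ContMDiffAt I (I.prod 𝓘(ℝ, F)) ∞ (fun y => (⟨y, s y⟩ : Bundle.TotalSpace F E)) x →
    lift ⟨x, s x⟩ =
      mfderiv I (I.prod 𝓘(ℝ, F)) (fun y => (⟨y, s y⟩ : Bundle.TotalSpace F E)) x →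
    lift ⟨x, c • s x⟩ =
      mfderiv I (I.prod 𝓘(ℝ, F)) (fun y => (⟨y, c • s y⟩ : Bundle.TotalSpace F E)) x

variable {I F E}

/-- The connection `K : E → T*M ⊗ TE` regarded as a tangent-valued 1-form on the total space:
`ξ ∈ T_e E` is sent to `K e (T_e p ξ)`. -/
def LinearConnection.form (K : LinearConnection I F E) :
    TangentValuedField (I.prod 𝓘(ℝ, F)) (Bundle.TotalSpace F E) 1 :=
  fun e v => K.lift e
    (mfderiv (I.prod 𝓘(ℝ, F)) I (Bundle.TotalSpace.proj : Bundle.TotalSpace F E → M) e (v 0))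

/-- The total space of a smooth vector bundle is a manifold (of class `C¹`, as needed to speak of
its tangent bundle as a vector bundle). -/
instance totalSpace_isManifold_one : IsManifold (I.prod 𝓘(ℝ, F)) 1 (Bundle.TotalSpace F E) :=
  haveI : IsManifold (I.prod 𝓘(ℝ, F)) ∞ (Bundle.TotalSpace F E) := inferInstance
  inferInstance

/-- The curvature `R[K] = -[K, K]`. -/
def LinearConnection.curvature (K : LinearConnection I F E) :
    TangentValuedField (I.prod 𝓘(ℝ, F)) (Bundle.TotalSpace F E) 2 :=
  fun e v => -fnBracket (k := 0) (l := 0) K.form K.form e v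

end LinearConnections

end

/-!
The identity `[K, [K, K]] = 0` holds for every smooth endomorphism `L` of the tangent bundle of a
manifold `N`, viewed as a tangent-valued `1`-form; that the connection form is a projection, and
that it is linear on fibres, plays no role. Evaluated on vector fields, `[L, L](X, Y)` is twice the
Nijenhuis torsion
`ν(X, Y) = [LX, LY] - L[LX, Y] - L[X, LY] + L²[X, Y]`.

When the Frölicher–Nijenhuis formula for `[L, ν]` is written out on arbitrary smooth vector fields
`X, Y, Z`, it becomes a cyclic sum of iterated Lie brackets, composed with powers of `L`. The terms
in which `L` is applied to the inner bracket cancel in pairs, and the others are collected by `L`,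
`L²` and `L³` into instances of the Jacobi identity (`bianchiSummand_cyclic_sum`). This computation
is purely formal: it needs neither commuting fields nor coordinates.

The curvature, however, is defined pointwise, at each `y` through extensions of tangent vectors
which depend on `y`. To identify it, as a field near a point, with `-2 ν(X, Y)`, one needs that `ν`
is tensorial in both arguments (`tensorialAt_nijenhuis_left`): the derivatives of a function `f`
multiplying `X` cancel in `ν(fX, Y)`. Tensoriality also gives that the curvature is a smooth
tangent-valued `2`-form. Finally, the connection form is smooth in the sense required, as the
composition of the differential of the projection and of the smooth horizontal lift
(`LinearConnection.isSmoothEndomorphism`).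
-/

/-! ### Signed sums over the permutations of two and of three indices -/

lemma sum_perm_fin_two_sign_smul {V : Type*} [AddCommGroup V] [Module ℝ V]
    (g : Fin 2 → Fin 2 → V) :
    ∑ σ : Equiv.Perm (Fin 2), ((Equiv.Perm.sign σ : ℤ) : ℝ) • g (σ 0) (σ 1)
      = g 0 1 - g 1 0 := by
  have h : (Finset.univ : Finset (Equiv.Perm (Fin 2))) = {1, Equiv.swap 0 1} := by decide
  rw [h, Finset.sum_pair (by decide)]
  simp [sub_eq_add_neg]

lemma sum_perm_fin_three_sign_smul {V : Type*} [AddCommGroup V] [Module ℝ V]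
    (g : Fin 3 → Fin 3 → Fin 3 → V) :
    ∑ σ : Equiv.Perm (Fin 3), ((Equiv.Perm.sign σ : ℤ) : ℝ) • g (σ 0) (σ 1) (σ 2)
      = g 0 1 2 + g 1 2 0 + g 2 0 1 - g 1 0 2 - g 2 1 0 - g 0 2 1 := by
  have h : (Finset.univ : Finset (Equiv.Perm (Fin 3))) =
      {1, Equiv.swap 0 1 * Equiv.swap 1 2, Equiv.swap 1 2 * Equiv.swap 0 1,
        Equiv.swap 0 1, Equiv.swap 0 2, Equiv.swap 1 2} := by decide
  have h01 : (Equiv.swap 0 1 : Equiv.Perm (Fin 3)) 2 = 2 := by decide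
  have h02 : (Equiv.swap 0 2 : Equiv.Perm (Fin 3)) 1 = 1 := by decide
  have h12 : (Equiv.swap 1 2 : Equiv.Perm (Fin 3)) 0 = 0 := by decide
  rw [h, Finset.sum_insert (by decide), Finset.sum_insert (by decide),
    Finset.sum_insert (by decide), Finset.sum_insert (by decide), Finset.sum_pair (by decide)]
  simp [h01, h02, h12]
  abel

section SmoothEndomorphism

open VectorField Topology FiberBundle

variable {EN : Type*} [NormedAddCommGroup EN] [NormedSpace ℝ EN]
  {HN : Type*} [TopologicalSpace HN] {J : ModelWithCorners ℝ EN HN}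
  {N : Type*} [TopologicalSpace N] [ChartedSpace HN N]

/-! ### Endomorphisms of the tangent bundle and the Nijenhuis torsion -/

/-- The vector field `LX`, for an endomorphism `L` of the tangent bundle and a vector field `X`. -/
noncomputable def mapField (L : ∀ x : N, TangentSpace J x →ₗ[ℝ] TangentSpace J x)
    (X : ∀ x : N, TangentSpace J x) : ∀ x : N, TangentSpace J x :=
  fun x => L x (X x)

/-- An endomorphism `L` of the tangent bundle is smooth. This is expressed by its action on vector
fields: `LX` is differentiable, resp. smooth, at every point at which `X` is. Differentiability is
asked for separately because the tensoriality criterion is about vector fields which are merely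
differentiable at a point. -/
structure IsSmoothEndomorphism [IsManifold J 1 N]
    (L : ∀ x : N, TangentSpace J x →ₗ[ℝ] TangentSpace J x) : Prop where
  mdifferentiableAt : ∀ (x : N) (X : ∀ y : N, TangentSpace J y),
    MDiffAt (T% X) x → MDiffAt (T% (mapField L X)) x
  contMDiffAt : ∀ (x : N) (X : ∀ y : N, TangentSpace J y),
    CMDiffAt ∞ (T% X) x → CMDiffAt ∞ (T% (mapField L X)) x

/-- The Nijenhuis torsion `[LX, LY] - L[LX, Y] - L[X, LY] + L²[X, Y]` of an endomorphism `L` of the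
tangent bundle. -/
noncomputable def nijenhuis (L : ∀ x : N, TangentSpace J x →ₗ[ℝ] TangentSpace J x)
    (X Y : ∀ x : N, TangentSpace J x) : ∀ x : N, TangentSpace J x :=
  mlieBracket J (mapField L X) (mapField L Y)
    - mapField L (mlieBracket J (mapField L X) Y)
    - mapField L (mlieBracket J X (mapField L Y))
    + mapField L (mapField L (mlieBracket J X Y))

variable {L : ∀ x : N, TangentSpace J x →ₗ[ℝ] TangentSpace J x}
  {X Y Z : ∀ x : N, TangentSpace J x} {x : N}

lemma mapField_apply (X : ∀ x : N, TangentSpace J x) (x : N) : mapField L X x = L x (X x) := rfl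

lemma mapField_add (X Y : ∀ x : N, TangentSpace J x) :
    mapField L (X + Y) = mapField L X + mapField L Y := by
  ext x; simp [mapField]

lemma mapField_smul (f : N → ℝ) (X : ∀ x : N, TangentSpace J x) :
    mapField L (f • X) = f • mapField L X := by
  ext x; simp [mapField]

lemma mapField_neg (X : ∀ x : N, TangentSpace J x) : mapField L (-X) = -mapField L X := by
  ext x; simp [mapField]

lemma nijenhuis_apply (x : N) :
    nijenhuis L X Y x = mlieBracket J (mapField L X) (mapField L Y) x
      - L x (mlieBracket J (mapField L X) Y x) - L x (mlieBracket J X (mapField L Y) x)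
      + L x (L x (mlieBracket J X Y x)) :=
  rfl

lemma nijenhuis_swap_apply : nijenhuis L X Y x = -nijenhuis L Y X x := by
  simp only [nijenhuis_apply]
  rw [mlieBracket_swap_apply (V := mapField L X) (W := mapField L Y),
    mlieBracket_swap_apply (V := mapField L X) (W := Y),
    mlieBracket_swap_apply (V := X) (W := mapField L Y),
    mlieBracket_swap_apply (V := X) (W := Y)]
  simp only [_root_.map_neg]
  module

lemma nijenhuis_swap (X Y : ∀ x : N, TangentSpace J x) : nijenhuis L X Y = -nijenhuis L Y X :=
  funext fun _ => nijenhuis_swap_apply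

/-- The torsion with `[X, LY]` written as `-[LY, X]`, so that the mixed brackets have one shape. -/
lemma nijenhuis_eq (X Y : ∀ x : N, TangentSpace J x) :
    nijenhuis L X Y = mlieBracket J (mapField L X) (mapField L Y)
      - mapField L (mlieBracket J (mapField L X) Y) + mapField L (mlieBracket J (mapField L Y) X)
      + mapField L (mapField L (mlieBracket J X Y)) := by
  ext x
  simp only [nijenhuis_apply, mapField_apply, Pi.add_apply, Pi.sub_apply]
  rw [mlieBracket_swap_apply (V := X) (W := mapField L Y), _root_.map_neg, sub_neg_eq_add]

/-- An endomorphism of the tangent bundle, regarded as a tangent-valued `1`-form. -/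
noncomputable def endomorphismForm (L : ∀ x : N, TangentSpace J x →ₗ[ℝ] TangentSpace J x) :
    TangentValuedField J N 1 :=
  fun x v => L x (v 0)

lemma fnBracketOnFields_endomorphismForm_self (X : Fin 2 → ∀ x : N, TangentSpace J x) (x : N) :
    fnBracketOnFields (k := 0) (l := 0) (endomorphismForm L) (endomorphismForm L) X x
      = (2 : ℝ) • nijenhuis L (X 0) (X 1) x := by
  have h1 := sum_perm_fin_two_sign_smul fun i j =>
    mlieBracket J (mapField L (X i)) (mapField L (X j)) x
  have h2 := sum_perm_fin_two_sign_smul fun i j => L x (mlieBracket J (mapField L (X i)) (X j) x)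
  have h3 := sum_perm_fin_two_sign_smul fun i j => L x (L x (mlieBracket J (X i) (X j) x))
  -- Each of the five sums, for one-forms, is a sum over the two permutations of the two fields.
  trans (1 / ((0 + 1).factorial * (0 + 1).factorial : ℝ)) • (∑ σ : Equiv.Perm (Fin 2),
        ((Equiv.Perm.sign σ : ℤ) : ℝ) •
          mlieBracket J (mapField L (X (σ 0))) (mapField L (X (σ 1))) x)
      - (1 / ((0 + 1).factorial * (0).factorial : ℝ)) • (∑ σ : Equiv.Perm (Fin 2),
        ((Equiv.Perm.sign σ : ℤ) : ℝ) • L x (mlieBracket J (mapField L (X (σ 0))) (X (σ 1)) x))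
      + ((-1) ^ ((0 + 1) * (0 + 1)) / ((0).factorial * (0 + 1).factorial : ℝ)) •
        (∑ σ : Equiv.Perm (Fin 2),
        ((Equiv.Perm.sign σ : ℤ) : ℝ) • L x (mlieBracket J (mapField L (X (σ 0))) (X (σ 1)) x))
      + ((-1) ^ 0 / ((0).factorial * (0).factorial * 2 : ℝ)) • (∑ σ : Equiv.Perm (Fin 2),
        ((Equiv.Perm.sign σ : ℤ) : ℝ) • L x (L x (mlieBracket J (X (σ 0)) (X (σ 1)) x)))
      + ((-1) ^ (0 * (0 + 1)) / ((0).factorial * (0).factorial * 2 : ℝ)) •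
        (∑ σ : Equiv.Perm (Fin 2),
        ((Equiv.Perm.sign σ : ℤ) : ℝ) • L x (L x (mlieBracket J (X (σ 0)) (X (σ 1)) x)))
  · rfl
  rw [h1, h2, h3, nijenhuis_apply,
    mlieBracket_swap_apply (V := mapField L (X 1)) (W := mapField L (X 0)),
    mlieBracket_swap_apply (V := mapField L (X 1)) (W := X 0),
    mlieBracket_swap_apply (V := X 1) (W := X 0)]
  simp only [_root_.map_neg]
  norm_num
  module

/-- The expression whose cyclic sum over `X, Y, Z` is the Frölicher–Nijenhuis bracket of `L` and its
torsion. -/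
noncomputable def bianchiSummand (L : ∀ x : N, TangentSpace J x →ₗ[ℝ] TangentSpace J x)
    (X Y Z : ∀ x : N, TangentSpace J x) (x : N) : TangentSpace J x :=
  mlieBracket J (mapField L X) (nijenhuis L Y Z) x
    - nijenhuis L (mlieBracket J (mapField L X) Y) Z x
    + nijenhuis L (mlieBracket J (mapField L X) Z) Y x
    + L x (mlieBracket J (nijenhuis L X Y) Z x)
    + nijenhuis L (mapField L (mlieBracket J X Y)) Z x
    + L x (nijenhuis L (mlieBracket J X Y) Z x)

variable [IsManifold J ∞ N] [FiniteDimensional ℝ EN]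

/-! ### The Lie bracket of smooth vector fields -/

lemma contMDiffAt_mlieBracket [IsManifold J 1 N]
    (hX : CMDiffAt ∞ (T% X) x) (hY : CMDiffAt ∞ (T% Y) x) :
    CMDiffAt ∞ (T% (mlieBracket J X Y)) x := by
  have : CompleteSpace EN := FiniteDimensional.complete ℝ EN
  have : IsManifold J (((⊤ : ℕ∞) : WithTop ℕ∞) + 1) N := ‹IsManifold J ∞ N›
  have : IsManifold J (minSmoothness ℝ 2) N := .of_le (n := ∞) (by simpa using ENat.LEInfty.out)
  have : IsManifold J (minSmoothness ℝ 3) N := .of_le (n := ∞) (by simpa using ENat.LEInfty.out)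
  exact ContMDiffAt.mlieBracket_vectorField (m := ⊤) (n := ⊤) hX hY (by simp)

/-- The Jacobi identity, in the form in which a simple field is the first argument of each outer
bracket. -/
lemma mlieBracket_leibniz [IsManifold J 1 N] (hX : CMDiffAt ∞ (T% X) x)
    (hY : CMDiffAt ∞ (T% Y) x) (hZ : CMDiffAt ∞ (T% Z) x) :
    mlieBracket J X (mlieBracket J Y Z) x = mlieBracket J Y (mlieBracket J X Z) x
      - mlieBracket J Z (mlieBracket J X Y) x := by
  have : CompleteSpace EN := FiniteDimensional.complete ℝ EN
  have : IsManifold J (minSmoothness ℝ 3) N := .of_le (n := ∞) (by simpa using ENat.LEInfty.out)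
  have h2 : minSmoothness ℝ 2 ≤ (∞ : WithTop ℕ∞) := by simpa using ENat.LEInfty.out
  rw [leibniz_identity_mlieBracket_apply (hX.of_le h2) (hY.of_le h2) (hZ.of_le h2),
    mlieBracket_swap_apply (V := mlieBracket J X Y)]
  abel

lemma mlieBracket_neg_right [IsManifold J 1 N] (hY : MDiffAt (T% Y) x) :
    mlieBracket J X (-Y) x = -mlieBracket J X Y x := by
  have : CompleteSpace EN := FiniteDimensional.complete ℝ EN
  rw [← neg_one_smul ℝ Y, mlieBracket_const_smul_right hY, neg_one_smul]

lemma mlieBracket_sub_right [IsManifold J 1 N] (hY : MDiffAt (T% Y) x) (hZ : MDiffAt (T% Z) x) :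
    mlieBracket J X (Y - Z) x = mlieBracket J X Y x - mlieBracket J X Z x := by
  have : CompleteSpace EN := FiniteDimensional.complete ℝ EN
  rw [sub_eq_add_neg, mlieBracket_add_right hY (mdifferentiableAt_neg_section hZ),
    mlieBracket_neg_right hZ, ← sub_eq_add_neg]

/-! ### Tensoriality and smoothness of the torsion -/

/-- The torsion is tensorial in its first argument: the terms `(LY f) LX` and `L((Y f) LX)` coming
from the Leibniz rule each occur twice, with opposite signs. No regularity of `Y` is needed. -/
lemma tensorialAt_nijenhuis_left [IsManifold J 1 N] (hL : IsSmoothEndomorphism L)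
    (Y : ∀ x : N, TangentSpace J x) : TensorialAt J EN (fun X => nijenhuis L X Y x) x where
  smul {f X} hf hX := by
    have : CompleteSpace EN := FiniteDimensional.complete ℝ EN
    have hX' := hL.mdifferentiableAt x X hX
    simp only [nijenhuis_apply, mapField_smul]
    rw [mlieBracket_smul_left hf hX', mlieBracket_smul_left hf hX, mlieBracket_smul_left hf hX',
      mlieBracket_smul_left hf hX]
    simp only [mapField_apply, _root_.map_add, _root_.map_smul]
    module
  add {X X'} hX hX' := by
    have : CompleteSpace EN := FiniteDimensional.complete ℝ EN
    have hLX := hL.mdifferentiableAt x X hX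
    have hLX' := hL.mdifferentiableAt x X' hX'
    simp only [nijenhuis_apply, mapField_add]
    rw [mlieBracket_add_left hX hX', mlieBracket_add_left hLX hLX', mlieBracket_add_left hX hX',
      mlieBracket_add_left hLX hLX']
    simp only [_root_.map_add]
    module

lemma tensorialAt_nijenhuis_right [IsManifold J 1 N] (hL : IsSmoothEndomorphism L)
    (X : ∀ x : N, TangentSpace J x) : TensorialAt J EN (fun Y => nijenhuis L X Y x) x where
  smul hf hY := by
    simp only [nijenhuis_swap_apply (X := X)]
    rw [(tensorialAt_nijenhuis_left hL X).smul hf hY, smul_neg]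
  add hY hY' := by
    simp only [nijenhuis_swap_apply (X := X)]
    rw [(tensorialAt_nijenhuis_left hL X).add hY hY', neg_add]

lemma contMDiffAt_nijenhuis [IsManifold J 1 N] (hL : IsSmoothEndomorphism L)
    (hX : CMDiffAt ∞ (T% X) x) (hY : CMDiffAt ∞ (T% Y) x) :
    CMDiffAt ∞ (T% (nijenhuis L X Y)) x := by
  have hLX := hL.contMDiffAt x X hX
  have hLY := hL.contMDiffAt x Y hY
  exact (((contMDiffAt_mlieBracket hLX hLY).sub_section
    (hL.contMDiffAt x _ (contMDiffAt_mlieBracket hLX hY))).sub_section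
    (hL.contMDiffAt x _ (contMDiffAt_mlieBracket hX hLY))).add_section
      (hL.contMDiffAt x _ (hL.contMDiffAt x _ (contMDiffAt_mlieBracket hX hY)))

lemma nijenhuis_neg_left_apply [IsManifold J 1 N] (hL : IsSmoothEndomorphism L)
    (hX : MDiffAt (T% X) x) : nijenhuis L (-X) Y x = -nijenhuis L X Y x := by
  have h := (tensorialAt_nijenhuis_left hL Y).smul (f := fun _ => -1) mdifferentiableAt_const hX
  rw [neg_one_smul] at h
  rw [← h]
  congr 1
  ext y
  simp

/-! ### The Bianchi identity for the torsion -/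

lemma mlieBracket_nijenhuis [IsManifold J 1 N] (hL : IsSmoothEndomorphism L)
    (hX : CMDiffAt ∞ (T% X) x) (hY : CMDiffAt ∞ (T% Y) x) (W : ∀ x : N, TangentSpace J x) :
    mlieBracket J W (nijenhuis L X Y) x =
      mlieBracket J W (mlieBracket J (mapField L X) (mapField L Y)) x
      - mlieBracket J W (mapField L (mlieBracket J (mapField L X) Y)) x
      + mlieBracket J W (mapField L (mlieBracket J (mapField L Y) X)) x
      + mlieBracket J W (mapField L (mapField L (mlieBracket J X Y))) x := by
  have : CompleteSpace EN := FiniteDimensional.complete ℝ EN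
  have hB : ∀ {U V : ∀ x : N, TangentSpace J x}, CMDiffAt ∞ (T% U) x →
      CMDiffAt ∞ (T% V) x → MDiffAt (T% (mlieBracket J U V)) x := fun hU hV =>
    (contMDiffAt_mlieBracket hU hV).mdifferentiableAt (by simp)
  have hLX := hL.contMDiffAt x X hX
  have hLY := hL.contMDiffAt x Y hY
  have h1 := hB hLX hLY
  have h2 := hL.mdifferentiableAt x _ (hB hLX hY)
  have h3 := hL.mdifferentiableAt x _ (hB hLY hX)
  have h4 := hL.mdifferentiableAt x _ (hL.mdifferentiableAt x _ (hB hX hY))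
  have h12 : MDiffAt (T% (mlieBracket J (mapField L X) (mapField L Y)
      - mapField L (mlieBracket J (mapField L X) Y))) x := mdifferentiableAt_sub_section h1 h2
  rw [nijenhuis_eq, mlieBracket_add_right (mdifferentiableAt_add_section h12 h3) h4,
    mlieBracket_add_right h12 h3, mlieBracket_sub_right h1 h2]

/-- The Bianchi identity for the torsion. After expansion, what does not cancel outright is
`[LX, [LY, LZ]]` and its cyclic permutations, together with `L`, `L²` and `L³` applied to iterated
brackets of three fields of which two, one and none, respectively, carry an `L`; all of these vanish
by the Jacobi identity. -/
lemma bianchiSummand_cyclic_sum [IsManifold J 1 N] (hL : IsSmoothEndomorphism L)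
    (hX : CMDiffAt ∞ (T% X) x) (hY : CMDiffAt ∞ (T% Y) x) (hZ : CMDiffAt ∞ (T% Z) x) :
    bianchiSummand L X Y Z x + bianchiSummand L Y Z X x + bianchiSummand L Z X Y x = 0 := by
  have hLX := hL.contMDiffAt x X hX
  have hLY := hL.contMDiffAt x Y hY
  have hLZ := hL.contMDiffAt x Z hZ
  have expand : ∀ {X Y Z : ∀ x : N, TangentSpace J x}, CMDiffAt ∞ (T% X) x →
      CMDiffAt ∞ (T% Y) x → CMDiffAt ∞ (T% Z) x → bianchiSummand L X Y Z x =
      (mlieBracket J (mapField L X) (mlieBracket J (mapField L Y) (mapField L Z)) x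
      - mlieBracket J (mapField L X) (mapField L (mlieBracket J (mapField L Y) Z)) x
      + mlieBracket J (mapField L X) (mapField L (mlieBracket J (mapField L Z) Y)) x
      + mlieBracket J (mapField L X) (mapField L (mapField L (mlieBracket J Y Z))) x)
      + (mlieBracket J (mapField L Z) (mapField L (mlieBracket J (mapField L X) Y)) x
      - L x (mlieBracket J (mapField L Z) (mlieBracket J (mapField L X) Y) x)
      - L x (mlieBracket J Z (mapField L (mlieBracket J (mapField L X) Y)) x)
      + L x (L x (mlieBracket J Z (mlieBracket J (mapField L X) Y) x)))
      - (mlieBracket J (mapField L Y) (mapField L (mlieBracket J (mapField L X) Z)) x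
      - L x (mlieBracket J (mapField L Y) (mlieBracket J (mapField L X) Z) x)
      - L x (mlieBracket J Y (mapField L (mlieBracket J (mapField L X) Z)) x)
      + L x (L x (mlieBracket J Y (mlieBracket J (mapField L X) Z) x)))
      - (L x (mlieBracket J Z (mlieBracket J (mapField L X) (mapField L Y)) x)
      - L x (mlieBracket J Z (mapField L (mlieBracket J (mapField L X) Y)) x)
      + L x (mlieBracket J Z (mapField L (mlieBracket J (mapField L Y) X)) x)
      + L x (mlieBracket J Z (mapField L (mapField L (mlieBracket J X Y))) x))
      - (mlieBracket J (mapField L Z) (mapField L (mapField L (mlieBracket J X Y))) x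
      - L x (mlieBracket J (mapField L Z) (mapField L (mlieBracket J X Y)) x)
      - L x (mlieBracket J Z (mapField L (mapField L (mlieBracket J X Y))) x)
      + L x (L x (mlieBracket J Z (mapField L (mlieBracket J X Y)) x)))
      - (L x (mlieBracket J (mapField L Z) (mapField L (mlieBracket J X Y)) x)
      - L x (L x (mlieBracket J (mapField L Z) (mlieBracket J X Y) x))
      - L x (L x (mlieBracket J Z (mapField L (mlieBracket J X Y)) x))
      + L x (L x (L x (mlieBracket J Z (mlieBracket J X Y) x)))) := by
    intro X Y Z hX hY hZ
    rw [bianchiSummand, mlieBracket_swap_apply (V := nijenhuis L X Y),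
      mlieBracket_nijenhuis hL hY hZ, mlieBracket_nijenhuis hL hX hY,
      nijenhuis_swap_apply (Y := Z), nijenhuis_swap_apply (Y := Z), nijenhuis_swap_apply (Y := Z),
      nijenhuis_swap_apply (Y := Y)]
    simp only [nijenhuis_apply, _root_.map_add, _root_.map_sub, _root_.map_neg]
    abel
  have jacobi : ∀ {U V W : ∀ x : N, TangentSpace J x}, CMDiffAt ∞ (T% U) x →
      CMDiffAt ∞ (T% V) x → CMDiffAt ∞ (T% W) x →
      mlieBracket J U (mlieBracket J V W) x = -mlieBracket J V (mlieBracket J W U) x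
        - mlieBracket J W (mlieBracket J U V) x := by
    intro U V W hU hV hW
    rw [mlieBracket_leibniz hU hV hW, mlieBracket_swap (V := U) (W := W), mlieBracket_neg_right
      ((contMDiffAt_mlieBracket hW hU).mdifferentiableAt (by simp))]
  have c0 := jacobi hLX hLY hLZ
  have c1 := congr(L x $(mlieBracket_leibniz hLX hLY hZ))
  have c2 := congr(L x $(mlieBracket_leibniz hLY hLZ hX))
  have c3 := congr(L x $(mlieBracket_leibniz hLZ hLX hY))
  have d1 := congr(L x (L x $(mlieBracket_leibniz hLX hY hZ)))
  have d2 := congr(L x (L x $(mlieBracket_leibniz hLY hZ hX)))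
  have d3 := congr(L x (L x $(mlieBracket_leibniz hLZ hX hY)))
  have e0 := congr(L x (L x (L x $(jacobi hX hY hZ))))
  rw [expand hX hY hZ, expand hY hZ hX, expand hZ hX hY, c0]
  simp only [_root_.map_sub, _root_.map_neg] at c1 c2 c3 d1 d2 d3 e0
  rw [c1, c2, c3, d1, d2, d3, e0]
  abel

/-! ### The form of an endomorphism and its curvature -/

/-- By tensoriality, the extensions used to define `fnBracket` may be replaced by any vector fields
which are differentiable at the point. -/
lemma fnBracket_endomorphismForm_self_apply [IsManifold J 1 N] (hL : IsSmoothEndomorphism L)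
    (X : Fin 2 → ∀ x : N, TangentSpace J x) (hX : ∀ i, MDiffAt (T% (X i)) x) :
    fnBracket (k := 0) (l := 0) (endomorphismForm L) (endomorphismForm L) x (fun i => X i x)
      = (2 : ℝ) • nijenhuis L (X 0) (X 1) x := by
  refine (fnBracketOnFields_endomorphismForm_self _ x).trans ?_
  congr 1
  exact TensorialAt.pointwise₂ (F := EN) (F' := EN) (Φ := fun X Y => nijenhuis L X Y x)
    (fun Y _ => tensorialAt_nijenhuis_left hL Y) (fun X _ => tensorialAt_nijenhuis_right hL X)
    (mdifferentiableAt_extend ..) (hX 0) (mdifferentiableAt_extend ..) (hX 1) (by simp) (by simp)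

/-- The curvature `-[L, L]` of an endomorphism `L` of the tangent bundle. -/
noncomputable def endomorphismCurvature [IsManifold J 1 N]
    (L : ∀ x : N, TangentSpace J x →ₗ[ℝ] TangentSpace J x) : TangentValuedField J N 2 :=
  fun x v => -fnBracket (k := 0) (l := 0) (endomorphismForm L) (endomorphismForm L) x v

lemma applyFields_endomorphismCurvature [IsManifold J 1 N] (hL : IsSmoothEndomorphism L)
    {A : Fin 2 → ∀ x : N, TangentSpace J x} (hA : ∀ i, MDiffAt (T% (A i)) x) :
    applyFields (endomorphismCurvature L) A x = (-2 : ℝ) • nijenhuis L (A 0) (A 1) x := by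
  rw [applyFields, endomorphismCurvature, fnBracket_endomorphismForm_self_apply hL A hA, neg_smul]

/-- The curvature agrees with `-2 ν` near a point at which the fields are smooth; as a Lie bracket is
a first order operator, the equality at the point itself would not suffice. -/
lemma eventuallyEq_applyFields_endomorphismCurvature [IsManifold J 1 N]
    (hL : IsSmoothEndomorphism L) {A : Fin 2 → ∀ x : N, TangentSpace J x}
    (hA : ∀ i, CMDiffAt ∞ (T% (A i)) x) :
    applyFields (endomorphismCurvature L) A =ᶠ[𝓝 x] (-2 : ℝ) • nijenhuis L (A 0) (A 1) := by
  -- A field which is `C^∞` at `x` need not be so near `x`, but it is `C^1` there.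
  have h : ∀ i, ∀ᶠ y in 𝓝 x, CMDiffAt 1 (T% (A i)) y := fun i =>
    (contMDiffAt_iff_contMDiffAt_nhds (by simp)).1 ((hA i).of_le (by simp))
  filter_upwards [h 0, h 1] with y h0 h1
  exact applyFields_endomorphismCurvature hL (Fin.forall_fin_two.2
    ⟨h0.mdifferentiableAt (by simp), h1.mdifferentiableAt (by simp)⟩)

lemma isTangentValuedForm_endomorphismCurvature [IsManifold J 1 N]
    (hL : IsSmoothEndomorphism L) : IsTangentValuedForm (endomorphismCurvature L) where
  alternating x := by
    have hl : ∀ Y, MDiffAt (T% Y) x → TensorialAt J EN (fun X => nijenhuis L X Y x) x :=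
      fun Y _ => tensorialAt_nijenhuis_left hL Y
    have hr : ∀ X, MDiffAt (T% X) x → TensorialAt J EN (fun Y => nijenhuis L X Y x) x :=
      fun X _ => tensorialAt_nijenhuis_right hL X
    let b := TensorialAt.mkHom₂ (fun X Y => nijenhuis L X Y x) x hl hr
    have hb : ∀ v : Fin 2 → TangentSpace J x,
        endomorphismCurvature L x v = (-2 : ℝ) • b (v 0) (v 1) := by
      intro v
      have := applyFields_endomorphismCurvature (x := x) hL
        (A := fun i => FiberBundle.extend EN (v i)) (fun i => mdifferentiableAt_extend ..)
      simp only [applyFields, FiberBundle.extend_apply_self] at this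
      exact this
    have hself : ∀ u, b u u = 0 := fun u => by
      have h : b u u = -b u u := nijenhuis_swap_apply
      have h' : b u u = 0 := by linear_combination (norm := module) (1 / 2 : ℝ) • h
      exact h'
    refine ⟨{ toFun := fun v => (-2 : ℝ) • b (v 0) (v 1)
              map_update_add' := ?_
              map_update_smul' := ?_
              map_eq_zero_of_eq' := ?_ }, funext hb⟩
    · intro _ v i u w
      fin_cases i <;> simp
    · intro _ v i c u
      fin_cases i <;> simp [smul_comm c]
    · intro v i j hv hij
      have h : v 0 = v 1 := by
        fin_cases i <;> fin_cases j <;> simp_all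
      simp [h, hself]
  smooth x A hA := by
    have h := (contMDiffAt_nijenhuis hL (hA 0) (hA 1)).const_smul_section (a := (-2 : ℝ))
    refine h.congr_of_eventuallyEq ?_
    filter_upwards [eventuallyEq_applyFields_endomorphismCurvature hL hA] with y hy
    rw [hy]

/-- The generalized Bianchi identity for a smooth endomorphism of the tangent bundle. -/
theorem fnBracketOnFields_endomorphismCurvature [IsManifold J 1 N] (hL : IsSmoothEndomorphism L)
    {X : Fin 3 → ∀ x : N, TangentSpace J x} (hX : ∀ i, CMDiffAt ∞ (T% (X i)) x) :
    fnBracketOnFields (k := 0) (l := 1) (endomorphismForm L) (endomorphismCurvature L) X x = 0 := by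
  have : CompleteSpace EN := FiniteDimensional.complete ℝ EN
  have hν : ∀ i j, MDiffAt (T% (nijenhuis L (X i) (X j))) x := fun i j =>
    (contMDiffAt_nijenhuis hL (hX i) (hX j)).mdifferentiableAt (by simp)
  have hB : ∀ i j, MDiffAt (T% (mlieBracket J (X i) (X j))) x := fun i j =>
    (contMDiffAt_mlieBracket (hX i) (hX j)).mdifferentiableAt (by simp)
  have hX' : ∀ i, MDiffAt (T% (X i)) x := fun i => (hX i).mdifferentiableAt (by simp)
  have r : ∀ i j (A : Fin 2 → ∀ x : N, TangentSpace J x), A 0 = X i → A 1 = X j →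
      applyFields (endomorphismCurvature L) A =ᶠ[𝓝 x] (-2 : ℝ) • nijenhuis L (X i) (X j) := by
    intro i j A h0 h1
    rw [← h0, ← h1]
    exact eventuallyEq_applyFields_endomorphismCurvature hL
      (Fin.forall_fin_two.2 ⟨h0 ▸ hX i, h1 ▸ hX j⟩)
  have r' : ∀ U i (A : Fin 2 → ∀ x : N, TangentSpace J x), MDiffAt (T% U) x → A 0 = U →
      A 1 = X i → applyFields (endomorphismCurvature L) A x
        = (-2 : ℝ) • nijenhuis L U (X i) x := by
    intro U i A hU h0 h1
    rw [← h0, ← h1]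
    exact applyFields_endomorphismCurvature hL (Fin.forall_fin_two.2 ⟨h0 ▸ hU, h1 ▸ hX' i⟩)
  have t1 : ∀ i j k (A : Fin 2 → ∀ x : N, TangentSpace J x), A 0 = X j → A 1 = X k →
      mlieBracket J (mapField L (X i)) (applyFields (endomorphismCurvature L) A) x
        = (-2 : ℝ) • mlieBracket J (mapField L (X i)) (nijenhuis L (X j) (X k)) x := by
    intro i j k A h0 h1
    rw [Filter.EventuallyEq.rfl.mlieBracket_vectorField_eq (r j k A h0 h1),
      mlieBracket_const_smul_right (hν j k)]
  have t3 : ∀ i j k (A : Fin 2 → ∀ x : N, TangentSpace J x), A 0 = X i → A 1 = X j →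
      L x (mlieBracket J (applyFields (endomorphismCurvature L) A) (X k) x)
        = (-2 : ℝ) • L x (mlieBracket J (nijenhuis L (X i) (X j)) (X k) x) := by
    intro i j k A h0 h1
    rw [(r i j A h0 h1).mlieBracket_vectorField_eq (.rfl : X k =ᶠ[𝓝 x] X k),
      mlieBracket_const_smul_left (hν i j), _root_.map_smul]
  -- The values of the summands of the five sums in the bracket.
  have e1 : ∀ σ : Equiv.Perm (Fin 3), _ := fun σ =>
    t1 (σ 0) (σ 1) (σ 2) (fun j : Fin 2 => X (σ ⟨0 + 1 + j, by omega⟩)) rfl rfl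
  have e2 : ∀ σ : Equiv.Perm (Fin 3), _ := fun σ =>
    r' _ (σ 2) (Fin.cons (mlieBracket J (mapField L (X (σ 0))) (X (σ 1)))
      (fun j : Fin 1 => X (σ ⟨0 + 2 + j, by omega⟩)))
      ((contMDiffAt_mlieBracket (hL.contMDiffAt x _ (hX (σ 0))) (hX (σ 1))).mdifferentiableAt
        (by simp)) rfl rfl
  have e3 : ∀ σ : Equiv.Perm (Fin 3), _ := fun σ =>
    t3 (σ 0) (σ 1) (σ 2) (fun j : Fin 2 => X (σ ⟨j, by omega⟩)) rfl rfl
  have e4 : ∀ σ : Equiv.Perm (Fin 3), _ := fun σ =>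
    r' (mapField L (mlieBracket J (X (σ 0)) (X (σ 1)))) (σ 2)
      (Fin.cons (mapField L (mlieBracket J (X (σ 0)) (X (σ 1))))
      (fun j : Fin 1 => X (σ ⟨0 + 2 + j, by omega⟩)))
      (hL.mdifferentiableAt x _ (hB _ _)) rfl rfl
  have e5 : ∀ σ : Equiv.Perm (Fin 3), _ := fun σ =>
    congrArg (L x) (r' (mlieBracket J (X (σ 0)) (X (σ 1))) (σ 2)
      (Fin.cons (mlieBracket J (X (σ 0)) (X (σ 1)))
      (fun j : Fin 1 => X (σ ⟨2 + j, by omega⟩))) (hB _ _) rfl rfl)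
  have s : ∀ f g : Equiv.Perm (Fin 3) → TangentSpace J x, (∀ σ, f σ = g σ) →
      ∑ σ, ((Equiv.Perm.sign σ : ℤ) : ℝ) • f σ = ∑ σ, ((Equiv.Perm.sign σ : ℤ) : ℝ) • g σ :=
    fun f g h => by simp only [h]
  have s1 := (s _ _ e1).trans (sum_perm_fin_three_sign_smul fun i j k =>
    (-2 : ℝ) • mlieBracket J (mapField L (X i)) (nijenhuis L (X j) (X k)) x)
  have s2 := (s _ _ e2).trans (sum_perm_fin_three_sign_smul fun i j k =>
    (-2 : ℝ) • nijenhuis L (mlieBracket J (mapField L (X i)) (X j)) (X k) x)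
  have s3 := (s _ _ e3).trans (sum_perm_fin_three_sign_smul fun i j k =>
    (-2 : ℝ) • L x (mlieBracket J (nijenhuis L (X i) (X j)) (X k) x))
  have s4 := (s _ _ e4).trans (sum_perm_fin_three_sign_smul fun i j k =>
    (-2 : ℝ) • nijenhuis L (mapField L (mlieBracket J (X i) (X j))) (X k) x)
  have s5 := (s _ _ e5).trans (sum_perm_fin_three_sign_smul fun i j k =>
    L x ((-2 : ℝ) • nijenhuis L (mlieBracket J (X i) (X j)) (X k) x))
  -- In four of the sums the summand is antisymmetric in a pair of arguments; the sum over all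
  -- permutations is then twice a cyclic sum.
  have n1 : ∀ i j k, mlieBracket J (mapField L (X i)) (nijenhuis L (X k) (X j)) x
      = -mlieBracket J (mapField L (X i)) (nijenhuis L (X j) (X k)) x := fun i j k => by
    rw [nijenhuis_swap, mlieBracket_neg_right (hν j k)]
  have n3 : ∀ i j k, mlieBracket J (nijenhuis L (X j) (X i)) (X k) x
      = -mlieBracket J (nijenhuis L (X i) (X j)) (X k) x := fun i j k => by
    rw [mlieBracket_swap_apply, nijenhuis_swap, mlieBracket_neg_right (hν i j),
      mlieBracket_swap_apply (W := nijenhuis L (X i) (X j)), neg_neg]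
  have n4 : ∀ i j k, nijenhuis L (mapField L (mlieBracket J (X j) (X i))) (X k) x
      = -nijenhuis L (mapField L (mlieBracket J (X i) (X j))) (X k) x := fun i j k => by
    rw [mlieBracket_swap, mapField_neg,
      nijenhuis_neg_left_apply hL (hL.mdifferentiableAt x _ (hB i j))]
  have n5 : ∀ i j k, nijenhuis L (mlieBracket J (X j) (X i)) (X k) x
      = -nijenhuis L (mlieBracket J (X i) (X j)) (X k) x := fun i j k => by
    rw [mlieBracket_swap, nijenhuis_neg_left_apply hL (hB i j)]
  have key := bianchiSummand_cyclic_sum hL (hX 0) (hX 1) (hX 2)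
  have comb : ∀ {a b c d e : ℝ} {S₁ S₂ S₃ S₄ S₅ T₁ T₂ T₃ T₄ T₅ : TangentSpace J x},
      S₁ = T₁ → S₂ = T₂ → S₃ = T₃ → S₄ = T₄ → S₅ = T₅ →
      a • S₁ - b • S₂ + c • S₃ + d • S₄ + e • S₅
        = a • T₁ - b • T₂ + c • T₃ + d • T₄ + e • T₅ := by
    rintro a b c d e _ _ _ _ _ _ _ _ _ _ rfl rfl rfl rfl rfl
    rfl
  unfold fnBracketOnFields
  refine (comb s1 s2 s3 s4 s5).trans ?_
  simp only [bianchiSummand] at key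
  rw [n1 0 1 2, n1 1 2 0, n1 2 0 1, n3 0 1 2, n3 1 2 0, n3 2 0 1, n4 0 1 2, n4 1 2 0, n4 2 0 1,
    n5 0 1 2, n5 1 2 0, n5 2 0 1]
  simp only [_root_.map_smul, _root_.map_neg, smul_neg]
  norm_num [Nat.factorial]
  linear_combination (norm := module) (-2 : ℝ) • key

end SmoothEndomorphism

/-! ### Linear connections -/

section LinearConnections

variable {EM : Type*} [NormedAddCommGroup EM] [NormedSpace ℝ EM]
  {HM : Type*} [TopologicalSpace HM] {I : ModelWithCorners ℝ EM HM}
  {M : Type*} [TopologicalSpace M] [ChartedSpace HM M] [IsManifold I ∞ M]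
  {F : Type*} [NormedAddCommGroup F] [NormedSpace ℝ F]
  {E : M → Type*} [TopologicalSpace (Bundle.TotalSpace F E)]
  [∀ x, AddCommGroup (E x)] [∀ x, Module ℝ (E x)] [∀ x, TopologicalSpace (E x)]
  [FiberBundle F E] [VectorBundle ℝ F E] [ContMDiffVectorBundle ∞ F E I]

/-- The endomorphism `ξ ↦ K e (T_e p ξ)` of the tangent bundle of the total space. -/
noncomputable def LinearConnection.endomorphism (K : LinearConnection I F E)
    (e : Bundle.TotalSpace F E) :
    TangentSpace (I.prod 𝓘(ℝ, F)) e →ₗ[ℝ] TangentSpace (I.prod 𝓘(ℝ, F)) e :=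
  (K.lift e).toLinearMap ∘ₗ
    (mfderiv (I.prod 𝓘(ℝ, F)) I (Bundle.TotalSpace.proj : Bundle.TotalSpace F E → M) e).toLinearMap

lemma LinearConnection.isSmoothEndomorphism (K : LinearConnection I F E) :
    IsSmoothEndomorphism K.endomorphism where
  mdifferentiableAt e X hX := by
    have : IsManifold I 1 M := .of_le (n := ∞) (by simp)
    have h : CMDiff 1 (tangentMap (I.prod 𝓘(ℝ, F)) I
        (Bundle.TotalSpace.proj : Bundle.TotalSpace F E → M)) :=
      ((Bundle.contMDiff_proj E).contMDiff_tangentMap (n := ∞)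
        (by rw [one_add_one_eq_two]; exact ENat.LEInfty.out))
    exact MDifferentiableAt.clm_apply_of_inCoordinates ((K.smooth e).mdifferentiableAt (by simp))
      ((h.contMDiffAt.mdifferentiableAt (by simp)).comp e hX) mdifferentiableAt_id
  contMDiffAt e X hX := by
    have : IsManifold I 1 M := .of_le (n := ∞) (by simp)
    have h : CMDiff ∞ (tangentMap (I.prod 𝓘(ℝ, F)) I
        (Bundle.TotalSpace.proj : Bundle.TotalSpace F E → M)) :=
      ((Bundle.contMDiff_proj E).contMDiff_tangentMap (n := ∞) (by simp))
    exact ContMDiffAt.clm_apply_of_inCoordinates (K.smooth e)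
      (h.contMDiffAt.comp e hX) contMDiffAt_id

end LinearConnections

theorem theorem1p6
    {EM : Type*} [NormedAddCommGroup EM] [NormedSpace ℝ EM] [FiniteDimensional ℝ EM]
    {M : Type*} [TopologicalSpace M] [ChartedSpace EM M] [IsManifold 𝓘(ℝ, EM) ∞ M]
    {F : Type*} [NormedAddCommGroup F] [NormedSpace ℝ F] [FiniteDimensional ℝ F]
    {E : M → Type*} [TopologicalSpace (Bundle.TotalSpace F E)]
    [∀ x, AddCommGroup (E x)] [∀ x, Module ℝ (E x)] [∀ x, TopologicalSpace (E x)]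
    [FiberBundle F E] [VectorBundle ℝ F E] [ContMDiffVectorBundle ∞ F E 𝓘(ℝ, EM)]
    (K : LinearConnection 𝓘(ℝ, EM) F E) :
    IsTangentValuedForm K.curvature ∧
      ∀ (e : Bundle.TotalSpace F E)
        (v : Fin 3 → TangentSpace (𝓘(ℝ, EM).prod 𝓘(ℝ, F)) e),
        fnBracket (k := 0) (l := 1) K.form K.curvature e v = 0 := by
  have : IsManifold (𝓘(ℝ, EM).prod 𝓘(ℝ, F)) ∞ (Bundle.TotalSpace F E) := inferInstance
  have hL := K.isSmoothEndomorphism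
  rw [show K.curvature = endomorphismCurvature K.endomorphism from rfl]
  refine ⟨isTangentValuedForm_endomorphismCurvature hL, fun e v => ?_⟩
  exact fnBracketOnFields_endomorphismCurvature hL
    (X := fun i => FiberBundle.extend (EM × F) (v i)) fun i => FiberBundle.contMDiffAt_extend ..
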